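/- Let $\alpha\in[0,\pi]$. A treasure and an exit are placed at unknown points of the perimeter of a unit disk, at known arc distance $\alpha$ (for $\alpha=0$ the two points coincide). Two robots start at the centre of the disk, can move anywhere in the disk with speed at most $1$, and detect the exit or the treasure only when they are at its exact location. The first robot to reach the treasure picks it up and from then on carries it. The communication is face-to-face: two robots can exchange information (everything they have done and seen so far) only while they are at the same point. The robots' motions are prescribed by a deterministic online algorithm that may depend on $\alpha$: each robot's motion may depend only on what it has detected, on whether and when it met the other robot, and on what it was told then. Theorem (face-to-face upper bound). For every $\alpha\in[0,\pi]$ there is such an algorithm which, for every placement of the treasure and the exit on the perimeter at arc distance $\alpha$, brings the treasure to the exit at time at most $$1+\pi-\frac{\alpha}{2}+3\sin\frac{\alpha}{2}.$$ -/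

import Mathlib

open scoped NNReal

/-- A hidden placement of the exit and the treasure on the perimeter of the unit disk of the plane
`ℂ`, at arc distance `α` (for two points of the unit circle, the length of a shortest arc between
them is the unoriented angle between them). -/
structure Placement (α : ℝ) where
  exit : ℂ
  treasure : ℂ
  norm_exit : ‖exit‖ = 1
  norm_treasure : ‖treasure‖ = 1
  arc_dist : InnerProductGeometry.angle exit treasure = α

/-- A robot's trajectory, as a function of time: it starts at the centre, stays in the closed unit
disk and has speed at most `1`. -/
structure IsTrajectory (p : ℝ≥0 → ℂ) : Prop where
  start : p 0 = 0
  mem_disk : ∀ t, ‖p t‖ ≤ 1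
  speed : LipschitzWith 1 p

/-- When the treasure is hidden at `T` and the robots move along `p 0` and `p 1`, robot `i` holds
the treasure at time `t`. The robot that first reaches the treasure picks it up and keeps it. (If
both robots arrive simultaneously, robot `0` takes it; they are then at the same point with the same
information, so the choice is immaterial.) -/
def Holds (T : ℂ) (p : Fin 2 → ℝ≥0 → ℂ) (i : Fin 2) (t : ℝ≥0) : Prop :=
  ∃ s ≤ t, p i s = T ∧ (∀ r < s, ∀ j, p j r ≠ T) ∧ ∀ j < i, p j s ≠ T

/-- At time `t` the treasure is at the point `z`: either it is carried by a robot that is at `z`, or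
it is still at its hidden place, which no robot has visited so far. -/
def TreasureAt (T : ℂ) (p : Fin 2 → ℝ≥0 → ℂ) (t : ℝ≥0) (z : ℂ) : Prop :=
  (∃ i, Holds T p i t ∧ p i t = z) ∨ (z = T ∧ ∀ s ≤ t, ∀ j, p j s ≠ T)

/-- What robot `i` detects at time `t` at its own location is the same under the placement `ω` with
robot motions `p` as under the placement `ω'` with robot motions `p'`: the exit is detected in both
cases or in neither, and likewise the treasure. -/
def SameDetection {α : ℝ} (ω ω' : Placement α) (p p' : Fin 2 → ℝ≥0 → ℂ)
    (i : Fin 2) (t : ℝ≥0) : Prop :=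
  (p i t = ω.exit ↔ p' i t = ω'.exit) ∧
    (TreasureAt ω.treasure p t (p i t) ↔ TreasureAt ω'.treasure p' t (p' i t))

/-- Everything that robot `i` perceives at time `t` is the same in both executions: what it detects
at its location, which robots are there, and, by communication with any robot that is there, that
robot's whole past: its motion and its detections up to time `t`. (What that robot was told by robot
`i` at earlier meetings is known to robot `i` anyway.) -/
def SameObservation {α : ℝ} (ω ω' : Placement α) (p p' : Fin 2 → ℝ≥0 → ℂ)
    (i : Fin 2) (t : ℝ≥0) : Prop :=
  SameDetection ω ω' p p' i t ∧
    ∀ j, (p j t = p i t ↔ p' j t = p' i t) ∧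
      (p j t = p i t → ∀ r ≤ t, p j r = p' j r ∧ SameDetection ω ω' p p' j r)

/-- A (deterministic) two-robot algorithm in the face-to-face model, for known arc distance `α`.
It is described by the motion of the two robots under every placement. The robots do not know the
placement: the motions of a robot under two placements may separate only after the robot, having
moved identically so far, has made an observation that distinguishes the two executions. -/
structure F2FAlgorithm (α : ℝ) where
  pos : Placement α → Fin 2 → ℝ≥0 → ℂ
  isTrajectory : ∀ ω i, IsTrajectory (pos ω i)
  online : ∀ ω ω' i t, pos ω i t ≠ pos ω' i t →
    ∃ s < t, (∀ r ≤ s, pos ω i r = pos ω' i r) ∧ ¬ SameObservation ω ω' (pos ω) (pos ω') i s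

/-- Under the placement `ω`, the treasure has been brought to the exit at time `β` or before. -/
def F2FAlgorithm.EvacuatesBy {α : ℝ} (𝒜 : F2FAlgorithm α) (ω : Placement α) (β : ℝ) : Prop :=
  ∃ t : ℝ≥0, (t : ℝ) ≤ β ∧ ∃ i, Holds ω.treasure (𝒜.pos ω) i t ∧ 𝒜.pos ω i t = ω.exit

/-- Treasure-evacuation with two robots in the face-to-face model, for arc distance `α`, can be
solved in (worst-case) time `β`. -/
def SolvableF2F (α β : ℝ) : Prop :=
  ∃ 𝒜 : F2FAlgorithm α, ∀ ω : Placement α, 𝒜.EvacuatesBy ω β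

/-!
Both robots walk to the same point of the perimeter and search it in opposite senses. A robot that
finds the exit looks for the treasure at the two points at arc distance `α` from it. A robot that
finds the treasure carries it to the two points where the exit may be if it is early enough for
that. If it is too late for that and the exit is behind, then the other robot has already found the
exit and looked for the treasure on the wrong side, and it is now on its way to the treasure along a
known chord. So the carrier goes to the point of this chord where the two would meet: if the other
robot is there, it knows the exit, and if it is not, the exit is ahead. Very late the exit cannot be
behind, as the other robot would have come to the treasure first.

The first pickup happens at most `π - α / 2 + sin (α / 2)` after the arrival at the perimeter, the
mean of two times that in the worst case add up to the whole perimeter without the arc `α` and with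
its chord `2 * sin (α / 2)` instead. In the worst case another such chord leads to the exit. For the
way from the meeting point to the exit ahead this is the inequality
`2 * x + sin (2 * x) + 2 * |sin (3 * x)| ≤ π + 2 * sin x` at `x = α / 2`.
-/

namespace TreasureHunt

/-! ### Trigonometric inequalities -/

section Trigonometry

open Real

variable {x : ℝ}

lemma sin_le_pi_sub (hx : x ≤ π) : sin x ≤ π - x :=
  (sin_pi_sub x).symm.trans_le (sin_le (sub_nonneg.2 hx))

lemma two_mul_sin_le_pi_sub_half (hx : x ≤ π) : 2 * sin x ≤ π - x / 2 := by
  linarith [sin_le_one x, sin_le_pi_sub hx, pi_gt_three]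

lemma sin_three_mul_sub_sin (x : ℝ) : sin (3 * x) - sin x = 2 * cos (2 * x) * sin x := by
  rw [sin_three_mul, cos_two_mul', cos_sq']
  ring

lemma neg_sin_three_mul_le_sin (h : 0 ≤ sin x) : -sin (3 * x) ≤ sin x := by
  have : 4 * (sin x * sin x ^ 2) ≤ 4 * (sin x * 1) := by gcongr; exact sin_sq_le_one x
  linarith [sin_three_mul x]

lemma two_mul_add_sin_add_sin_three_mul_le (h0 : 0 ≤ x) (hx : x ≤ π / 2) :
    2 * x + sin (2 * x) + 2 * sin (3 * x) ≤ π + 2 * sin x := by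
  have hsin : 0 ≤ sin x := sin_nonneg_of_nonneg_of_le_pi h0 (by linarith [pi_pos])
  have hdiff := sin_three_mul_sub_sin x
  set w := π / 2 - 2 * x with hw
  have hcos : cos (2 * x) = sin w := (sin_pi_div_two_sub _).symm
  rcases le_total w 0 with hw0 | hw0
  · have : sin w * sin x ≤ 0 := mul_nonpos_of_nonpos_of_nonneg
      (sin_nonpos_of_nonpos_of_neg_pi_le hw0 (by linarith [pi_pos])) hsin
    rw [hcos] at hdiff
    linarith [sin_le_pi_sub (x := 2 * x) (by linarith)]
  · have hprod : cos (2 * x) * sin x ≤ w * x := by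
      rw [hcos]
      exact mul_le_mul (sin_le hw0) (sin_le h0) hsin hw0
    have hsin2 : sin (2 * x) ≤ 1 - w ^ 2 / 5 := by
      have hπ : (1 : ℝ) / 5 ≤ 2 / π ^ 2 := by
        rw [div_le_div_iff₀ (by norm_num) (by positivity)]
        nlinarith [pi_lt_d2, pi_pos]
      have := cos_le_one_sub_mul_cos_sq (x := w) (by rw [abs_of_nonneg hw0]; linarith [pi_pos])
      rw [hw, cos_pi_div_two_sub, ← hw] at this
      linarith [mul_le_mul_of_nonneg_right hπ (sq_nonneg w)]
    have hquad : 1 + (π - 1) * w - 11 / 5 * w ^ 2 ≤ π / 2 := by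
      nlinarith [sq_nonneg (w - 5 / 22 * (π - 1)), pi_gt_d2, pi_lt_d2]
    linear_combination hquad + hsin2 + 2 * hdiff + 4 * hprod

lemma two_mul_add_sin_add_abs_sin_three_mul_le (h0 : 0 ≤ x) (hx : x ≤ π / 2) :
    2 * x + sin (2 * x) + 2 * |sin (3 * x)| ≤ π + 2 * sin x := by
  have hsin : 0 ≤ sin x := sin_nonneg_of_nonneg_of_le_pi h0 (by linarith [pi_pos])
  rcases abs_cases (sin (3 * x)) with ⟨h, -⟩ | ⟨h, -⟩ <;> rw [h]
  · exact two_mul_add_sin_add_sin_three_mul_le h0 hx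
  · linarith [neg_sin_three_mul_le_sin hsin, sin_le_pi_sub (x := 2 * x) (by linarith)]

end Trigonometry

/-! ### Motions -/

section Concat

variable {X : Type*} {c t : ℝ} {f g : ℝ → X}

/-- The motion `f` up to time `c`, followed by the motion `g`, whose clock starts at time `c`. -/
noncomputable def concat (c : ℝ) (f g : ℝ → X) (t : ℝ) : X :=
  if t ≤ c then f t else g (t - c)

lemma concat_of_le (h : t ≤ c) : concat c f g t = f t := if_pos h

lemma concat_add (hfg : f c = g 0) (ht : 0 ≤ t) : concat c f g (c + t) = g t := by
  rcases ht.eq_or_lt with rfl | ht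
  · rw [add_zero, concat_of_le le_rfl, hfg]
  · rw [concat, if_neg (by linarith), add_sub_cancel_left]

lemma concat_mem {s : Set X} (hf : ∀ t ≥ 0, t ≤ c → f t ∈ s) (hg : ∀ t ≥ 0, g t ∈ s)
    (ht : 0 ≤ t) : concat c f g t ∈ s := by
  rw [concat]
  split_ifs with h
  · exact hf t ht h
  · exact hg _ (by linarith)

lemma lipschitzWith_concat [PseudoMetricSpace X] {K : ℝ≥0} (hf : LipschitzWith K f)
    (hg : LipschitzWith K g) (hfg : f c = g 0) : LipschitzWith K (concat c f g) := by
  refine LipschitzWith.of_dist_le_mul fun s t => ?_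
  wlog hst : s ≤ t generalizing s t
  · rw [dist_comm, dist_comm s]
    exact this t s (le_of_not_ge hst)
  rcases le_or_gt t c with htc | htc
  · rw [concat_of_le htc, concat_of_le (hst.trans htc)]
    exact hf.dist_le_mul s t
  rw [concat, concat, if_neg htc.not_ge]
  split_ifs with hsc
  · calc dist (f s) (g (t - c))
        ≤ dist (f s) (f c) + dist (g 0) (g (t - c)) := hfg ▸ dist_triangle _ _ _
      _ ≤ K * dist s c + K * dist 0 (t - c) := add_le_add (hf.dist_le_mul _ _) (hg.dist_le_mul _ _)
      _ = K * dist s t := by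
        rw [Real.dist_eq, Real.dist_eq, Real.dist_eq, abs_of_nonpos (by linarith),
          abs_of_neg (by linarith), abs_of_nonpos (by linarith)]
        ring
  · simpa only [dist_sub_right] using hg.dist_le_mul (s - c) (t - c)

end Concat

section Walk

variable {E : Type*} [NormedAddCommGroup E] [NormedSpace ℝ E] {a b : E} {l : List E}
  {s : Set E} {t : ℝ}

/-- The unit speed motion along a straight line that is at `a` at time `0` and at `b` at time
`dist a b` (at rest if `a = b`). -/
noncomputable def leg (a b : E) (t : ℝ) : E := AffineMap.lineMap a b (t / dist a b)

lemma leg_zero (a b : E) : leg a b 0 = a := by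
  rw [leg, zero_div, AffineMap.lineMap_apply_zero]

lemma leg_dist (a b : E) : leg a b (dist a b) = b := by
  rcases eq_or_ne a b with rfl | h
  · rw [dist_self, leg_zero]
  · rw [leg, div_self (dist_ne_zero.2 h), AffineMap.lineMap_apply_one]

lemma leg_symm (a b : E) (t : ℝ) : leg b a t = leg a b (dist a b - t) := by
  rcases eq_or_ne a b with rfl | h
  · simp only [leg, AffineMap.lineMap_same_apply]
  · rw [leg, leg, sub_div, div_self (dist_ne_zero.2 h), AffineMap.lineMap_apply_one_sub, dist_comm]

lemma dist_leg_leg_le (a b : E) (r t : ℝ) : dist (leg a b r) (leg a b t) ≤ dist r t := by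
  rw [leg, leg, dist_lineMap_lineMap, Real.dist_eq, ← sub_div, abs_div, abs_of_nonneg dist_nonneg,
    div_mul_comm]
  exact mul_le_of_le_one_left (abs_nonneg _) (div_self_le_one _)

lemma lipschitzWith_leg (a b : E) : LipschitzWith 1 (leg a b) :=
  LipschitzWith.mk_one (dist_leg_leg_le a b)

lemma leg_mem_segment (ht : 0 ≤ t) (h : t ≤ dist a b) : leg a b t ∈ segment ℝ a b := by
  rw [segment_eq_image_lineMap]
  exact ⟨_, ⟨div_nonneg ht dist_nonneg, div_le_one_of_le₀ h dist_nonneg⟩, rfl⟩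

lemma dist_left_leg (ht : 0 ≤ t) (h : t ≤ dist a b) : dist a (leg a b t) = t := by
  rcases eq_or_ne a b with rfl | hab
  · rw [dist_self] at h
    rw [le_antisymm h ht, leg_zero, dist_self]
  · rw [leg, dist_left_lineMap, Real.norm_of_nonneg (by positivity),
      div_mul_cancel₀ _ (dist_ne_zero.2 hab)]

lemma dist_leg_le_max (ht : 0 ≤ t) (h : t ≤ dist a b) (c : E) :
    dist (leg a b t) c ≤ max (dist a c) (dist b c) :=
  (convexOn_dist c convex_univ).le_on_segment trivial trivial (leg_mem_segment ht h)

lemma norm_leg_lt [StrictConvexSpace ℝ E] {r : ℝ} (ha : ‖a‖ ≤ r) (hb : ‖b‖ ≤ r) (ht : 0 < t)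
    (h : t < dist a b) : ‖leg a b t‖ < r := by
  have hd : 0 < dist a b := ht.trans h
  rw [leg, AffineMap.lineMap_apply_module]
  exact norm_combo_lt_of_ne ha hb (dist_pos.1 hd) (sub_pos.2 ((div_lt_one hd).2 h))
    (div_pos ht hd) (sub_add_cancel _ _)

/-- The unit speed motion that starts at `a` at time `0`, visits the given points one after the
other along straight lines, and stays at the last one. -/
noncomputable def walk (a : E) : List E → ℝ → E
  | [] => fun _ => a
  | b :: l => concat (dist a b) (leg a b) (walk b l)

lemma walk_zero (a : E) (l : List E) : walk a l 0 = a := by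
  cases l with
  | nil => rfl
  | cons b l => rw [walk, concat_of_le dist_nonneg, leg_zero]

lemma walk_of_le (h : t ≤ dist a b) : walk a (b :: l) t = leg a b t := concat_of_le h

lemma walk_dist_add (ht : 0 ≤ t) : walk a (b :: l) (dist a b + t) = walk b l t :=
  concat_add (by rw [leg_dist, walk_zero]) ht

lemma walk_dist (a b : E) (l : List E) : walk a (b :: l) (dist a b) = b := by
  rw [walk_of_le le_rfl, leg_dist]

lemma walk_dist_add_dist (a b c : E) (l : List E) :
    walk a (b :: c :: l) (dist a b + dist b c) = c := by
  rw [walk_dist_add dist_nonneg, walk_dist]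

lemma lipschitzWith_walk (a : E) (l : List E) : LipschitzWith 1 (walk a l) := by
  induction l generalizing a with
  | nil => exact LipschitzWith.const' a
  | cons b l ih =>
    exact lipschitzWith_concat (lipschitzWith_leg a b) (ih b) (by rw [leg_dist, walk_zero])

lemma walk_mem (hs : Convex ℝ s) (ha : a ∈ s) (hl : ∀ b ∈ l, b ∈ s) (ht : 0 ≤ t) :
    walk a l t ∈ s := by
  induction l generalizing a t with
  | nil => exact ha
  | cons b l ih =>
    have hb := hl b List.mem_cons_self
    exact concat_mem (fun r hr h => hs.segment_subset ha hb (leg_mem_segment hr h))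
      (fun r hr => ih hb (fun z hz => hl z (List.mem_cons_of_mem b hz)) hr) ht

end Walk

/-! ### Searching the unit circle -/

section Circle

variable {ε : ℤˣ} {z w : ℂ} {θ : ℝ}

/-- The unit complex number at angle `θ`, measured in the sense of rotation `ε`. -/
noncomputable def turn (ε : ℤˣ) (θ : ℝ) : ℂ := Circle.exp (((ε : ℤ) : ℝ) * θ)

lemma norm_turn (ε : ℤˣ) (θ : ℝ) : ‖turn ε θ‖ = 1 := Circle.norm_coe _

lemma turn_zero (ε : ℤˣ) : turn ε 0 = 1 := by rw [turn, mul_zero, Circle.exp_zero, Circle.coe_one]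

lemma turn_add (ε : ℤˣ) (θ φ : ℝ) : turn ε (θ + φ) = turn ε θ * turn ε φ := by
  rw [turn, mul_add, Circle.exp_add, Circle.coe_mul, turn, turn]

lemma turn_neg (ε : ℤˣ) (θ : ℝ) : turn (-ε) θ = turn ε (-θ) := by
  rw [turn, turn, Units.val_neg, Int.cast_neg, neg_mul_comm]

lemma turn_mul_turn_neg (ε : ℤˣ) (θ : ℝ) : turn ε θ * turn ε (-θ) = 1 := by
  rw [← turn_add, add_neg_cancel, turn_zero]

lemma eq_mul_turn_neg_iff (ε : ℤˣ) (z w : ℂ) (θ : ℝ) :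
    z = w * turn (-ε) θ ↔ w = z * turn ε θ := by
  rw [turn_neg]
  constructor <;> rintro rfl
  · rw [mul_assoc, mul_comm (turn _ _), turn_mul_turn_neg, mul_one]
  · rw [mul_assoc, turn_mul_turn_neg, mul_one]

lemma periodic_turn (ε : ℤˣ) : Function.Periodic (turn ε) (2 * Real.pi) := fun θ => by
  rcases Int.units_eq_one_or ε with rfl | rfl <;> simp [turn, mul_add]

lemma turn_injOn (ε : ℤˣ) : Set.InjOn (turn ε) (Set.Ico 0 (2 * Real.pi)) := by
  intro θ hθ φ hφ heq
  refine Circle.exp_injOn_Ico (sub_zero _).le hθ hφ ?_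
  rw [turn, turn, Circle.coe_inj] at heq
  rcases Int.units_eq_one_or ε with rfl | rfl
  · simpa using heq
  · simpa [Circle.exp_neg] using heq

lemma turn_mul_arg (ε : ℤˣ) (hz : ‖z‖ = 1) : turn ε (((ε : ℤ) : ℝ) * z.arg) = z := by
  have harg := Complex.norm_mul_exp_arg_mul_I z
  rw [hz, Complex.ofReal_one, one_mul, ← Circle.coe_exp] at harg
  rcases Int.units_eq_one_or ε with rfl | rfl <;> simpa [turn] using harg

lemma eq_mul_turn_angle_or (ε : ℤˣ) (hz : ‖z‖ = 1) (hw : ‖w‖ = 1) :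
    w = z * turn ε (InnerProductGeometry.angle z w) ∨
      w = z * turn ε (-InnerProductGeometry.angle z w) := by
  have hz0 : z ≠ 0 := norm_ne_zero_iff.1 (hz.trans_ne one_ne_zero)
  have hw0 : w ≠ 0 := norm_ne_zero_iff.1 (hw.trans_ne one_ne_zero)
  have hturn := turn_mul_arg ε (z := w / z) (by rw [norm_div, hz, hw, div_one])
  have habs : InnerProductGeometry.angle z w = |((ε : ℤ) : ℝ) * (w / z).arg| := by
    rw [InnerProductGeometry.angle_comm, Complex.angle_eq_abs_arg hw0 hz0, abs_mul,
      ← Int.cast_abs, Int.isUnit_iff_abs_eq.1 ε.isUnit, Int.cast_one, one_mul]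
  rw [eq_div_iff hz0, mul_comm] at hturn
  rw [habs]
  rcases abs_choice (((ε : ℤ) : ℝ) * (w / z).arg) with h | h <;> rw [h]
  · exact .inl hturn.symm
  · exact .inr (by rw [neg_neg, hturn])

lemma norm_turn_sub_one (ε : ℤˣ) (θ : ℝ) : ‖turn ε θ - 1‖ = 2 * |Real.sin (θ / 2)| := by
  rw [turn, Circle.coe_exp, mul_comm, Complex.norm_exp_I_mul_ofReal_sub_one, norm_mul,
    Real.norm_two, Real.norm_eq_abs]
  rcases Int.units_eq_one_or ε with rfl | rfl <;> simp [neg_div]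

lemma dist_mul_turn (hz : ‖z‖ = 1) (ε : ℤˣ) (θ φ : ℝ) :
    dist (z * turn ε θ) (z * turn ε φ) = 2 * |Real.sin ((θ - φ) / 2)| := by
  rw [dist_eq_norm, ← mul_sub, norm_mul, hz, one_mul, ← norm_turn_sub_one ε,
    ← mul_one ‖turn ε (θ - φ) - 1‖, ← norm_turn ε φ, ← norm_mul, sub_mul, ← turn_add,
    sub_add_cancel, one_mul]

lemma dist_mul_turn_right (hz : ‖z‖ = 1) (ε : ℤˣ) (θ : ℝ) :
    dist z (z * turn ε θ) = 2 * |Real.sin (θ / 2)| := by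
  have := dist_mul_turn hz ε 0 θ
  rwa [turn_zero, mul_one, zero_sub, neg_div, Real.sin_neg, abs_neg] at this

lemma lipschitzWith_turn (ε : ℤˣ) : LipschitzWith 1 (turn ε) := by
  refine LipschitzWith.mk_one fun θ φ => ?_
  have h := dist_mul_turn norm_one ε θ φ
  have hsin := Real.abs_sin_le_abs (x := (θ - φ) / 2)
  rw [one_mul, one_mul] at h
  rw [h, Real.dist_eq]
  rw [abs_div, abs_two] at hsin
  linarith

/-- The angle in `[0, 2π)` through which a search of the unit circle in the sense `ε`, starting at
the point `1`, has turned when it first reaches `z`. -/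
noncomputable def hit (ε : ℤˣ) (z : ℂ) : ℝ :=
  toIcoMod Real.two_pi_pos 0 (((ε : ℤ) : ℝ) * z.arg)

lemma hit_mem_Ico (ε : ℤˣ) (z : ℂ) : hit ε z ∈ Set.Ico 0 (2 * Real.pi) :=
  toIcoMod_mem_Ico' Real.two_pi_pos _

lemma hit_nonneg (ε : ℤˣ) (z : ℂ) : 0 ≤ hit ε z := (hit_mem_Ico ε z).1

lemma hit_lt (ε : ℤˣ) (z : ℂ) : hit ε z < 2 * Real.pi := (hit_mem_Ico ε z).2

lemma turn_hit (ε : ℤˣ) (hz : ‖z‖ = 1) : turn ε (hit ε z) = z := by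
  rw [hit, toIcoMod, (periodic_turn ε).sub_zsmul_eq, turn_mul_arg ε hz]

lemma hit_eq (hθ : θ ∈ Set.Ico 0 (2 * Real.pi)) (h : turn ε θ = z) : hit ε z = θ :=
  turn_injOn ε (hit_mem_Ico ε z) hθ
    ((turn_hit ε (by rw [← h, norm_turn])).trans h.symm)

lemma hit_neg_of_pos (hz : ‖z‖ = 1) (h : 0 < hit ε z) : hit (-ε) z = 2 * Real.pi - hit ε z :=
  hit_eq ⟨by linarith [hit_lt ε z], by linarith⟩
    (by rw [turn_neg, neg_sub, (periodic_turn ε).sub_eq, turn_hit ε hz])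

lemma hit_neg_of_eq_zero (hz : ‖z‖ = 1) (h : hit ε z = 0) : hit (-ε) z = 0 :=
  hit_eq ⟨le_rfl, Real.two_pi_pos⟩ (by rw [turn_zero, ← turn_zero ε, ← h, turn_hit ε hz])

lemma hit_mul_turn (hz : ‖z‖ = 1) (hθ : θ ∈ Set.Ico 0 (2 * Real.pi)) :
    hit ε (z * turn ε θ) = hit ε z + θ ∨ hit ε (z * turn ε θ) = hit ε z + θ - 2 * Real.pi := by
  have hturn : turn ε (hit ε z + θ) = z * turn ε θ := by rw [turn_add, turn_hit ε hz]
  have hz0 := hit_nonneg ε z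
  have hz1 := hit_lt ε z
  rcases lt_or_ge (hit ε z + θ) (2 * Real.pi) with h | h
  · exact .inl (hit_eq ⟨add_nonneg hz0 hθ.1, h⟩ hturn)
  · exact .inr (hit_eq ⟨by linarith, by linarith [hθ.2]⟩ (by rw [(periodic_turn ε).sub_eq, hturn]))

lemma hit_mul_turn_of_le (hz : ‖z‖ = 1) (hθ : θ ∈ Set.Ico 0 (2 * Real.pi))
    (h : hit ε z ≤ hit ε (z * turn ε θ)) : hit ε (z * turn ε θ) = hit ε z + θ :=
  (hit_mul_turn hz hθ).resolve_right fun h' => by linarith [hθ.2]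

lemma hit_mul_turn_of_lt (hz : ‖z‖ = 1) (hθ : θ ∈ Set.Ico 0 (2 * Real.pi))
    (h : hit ε (z * turn ε θ) < hit ε z) :
    hit ε (z * turn ε θ) = hit ε z + θ - 2 * Real.pi :=
  (hit_mul_turn hz hθ).resolve_left fun h' => by linarith [hθ.1]

end Circle

/-! ### The tour of a robot -/

section Tour

variable {α : ℝ} {ε : ℤˣ} {ω : Placement α} {z : ℂ} {t τ : ℝ}

lemma arc_mem_Icc (ω : Placement α) : α ∈ Set.Icc 0 Real.pi := by
  rw [← ω.arc_dist]
  exact ⟨InnerProductGeometry.angle_nonneg _ _, InnerProductGeometry.angle_le_pi _ _⟩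

lemma arc_mem_Ico (ω : Placement α) : α ∈ Set.Ico 0 (2 * Real.pi) :=
  ⟨(arc_mem_Icc ω).1, by linarith [(arc_mem_Icc ω).2, Real.pi_pos]⟩

lemma sin_arc_nonneg (ω : Placement α) : 0 ≤ Real.sin α :=
  Real.sin_nonneg_of_mem_Icc (arc_mem_Icc ω)

lemma sin_half_arc_nonneg (ω : Placement α) : 0 ≤ Real.sin (α / 2) := by
  have h := arc_mem_Icc ω
  exact Real.sin_nonneg_of_nonneg_of_le_pi (by linarith [h.1]) (by linarith [h.1, h.2])

lemma dist_mul_turn_arc (ω : Placement α) (hz : ‖z‖ = 1) (ε : ℤˣ) :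
    dist z (z * turn ε α) = 2 * Real.sin (α / 2) := by
  rw [dist_mul_turn_right hz, abs_of_nonneg (sin_half_arc_nonneg ω)]

lemma dist_mul_turn_neg_arc (ω : Placement α) (hz : ‖z‖ = 1) (ε : ℤˣ) :
    dist z (z * turn ε (-α)) = 2 * Real.sin (α / 2) := by
  rw [← turn_neg, dist_mul_turn_arc ω hz]

lemma dist_mul_turn_arc_mul_turn_neg_arc (ω : Placement α) (hz : ‖z‖ = 1) (ε : ℤˣ) :
    dist (z * turn ε α) (z * turn ε (-α)) = 2 * Real.sin α := by
  rw [dist_mul_turn hz, sub_neg_eq_add, add_self_div_two, abs_of_nonneg (sin_arc_nonneg ω)]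

/-- In the sense of rotation `ε`, the treasure follows the exit at distance `α`. A robot that finds
the exit then has the treasure ahead of it, and a robot that finds the treasure has the exit behind
it. -/
def TreasureAhead (ε : ℤˣ) (ω : Placement α) : Prop := ω.treasure = ω.exit * turn ε α

lemma treasureAhead_neg_iff : TreasureAhead (-ε) ω ↔ ω.exit = ω.treasure * turn ε α :=
  eq_mul_turn_neg_iff ε _ _ _

lemma treasureAhead_iff : TreasureAhead ε ω ↔ ω.exit = ω.treasure * turn ε (-α) := by
  rw [← turn_neg]
  exact (eq_mul_turn_neg_iff ε _ _ _).symm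

lemma treasureAhead_or_neg (ε : ℤˣ) (ω : Placement α) :
    TreasureAhead ε ω ∨ TreasureAhead (-ε) ω := by
  have h := eq_mul_turn_angle_or ε ω.norm_exit ω.norm_treasure
  rwa [ω.arc_dist, ← turn_neg] at h

lemma arc_eq_zero_of_treasure_eq_exit (h : ω.treasure = ω.exit) : α = 0 := by
  rw [← ω.arc_dist, h, InnerProductGeometry.angle_self]
  exact norm_ne_zero_iff.1 (ω.norm_exit.trans_ne one_ne_zero)

open Classical in
/-- The time at which a robot that searches in the sense `ε` reaches the hiding place of the
treasure, provided that the treasure is still there. A robot that finds the exit first looks for the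
treasure at distance `α` ahead of the exit, and then at distance `α` behind it. The clock starts
when the robots arrive at the perimeter. -/
noncomputable def reach (ε : ℤˣ) (ω : Placement α) : ℝ :=
  if hit ε ω.treasure < hit ε ω.exit then hit ε ω.treasure
  else if TreasureAhead ε ω then hit ε ω.exit + 2 * Real.sin (α / 2)
  else hit ε ω.exit + 2 * Real.sin (α / 2) + 2 * Real.sin α

/-- The robot that searches in the sense `ε` is (one of) the first to reach the treasure. -/
def IsFirst (ε : ℤˣ) (ω : Placement α) : Prop := ∀ δ, reach ε ω ≤ reach δ ω

/-- The robot that searches in the sense `ε` finds the treasure in its search, before it finds the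
exit and before the other robot takes the treasure away. -/
def Grabs (ε : ℤˣ) (ω : Placement α) : Prop := hit ε ω.treasure < hit ε ω.exit ∧ IsFirst ε ω

/-- The time at which a robot that has found the treasure expects to meet the other robot, if the
exit is behind. The other robot has then found the exit and, at distance `α` beyond it, no treasure,
and is on its way to the hiding place of the treasure. -/
noncomputable def meetTime (α : ℝ) : ℝ := α / 2 + Real.sin (α / 2) + Real.sin α

/-- The latest time at which the treasure is picked up. -/
noncomputable def latestPickup (α : ℝ) : ℝ := Real.pi - α / 2 + Real.sin (α / 2)

/-- The latest pickup time after which there is enough time left for visiting both of the points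
where the exit may be. -/
noncomputable def soloTime (α : ℝ) : ℝ := latestPickup α - 2 * Real.sin α

/-- The place of the meeting at `meetTime`, when the treasure is found at `T`. It is on the chord
from `T` to `T * turn ε (-(2 * α))`, along which the other robot approaches `T`. -/
noncomputable def meetPoint (α : ℝ) (ε : ℤˣ) (T : ℂ) : ℂ :=
  leg T (T * turn ε (-(2 * α))) (meetTime α - hit ε T)

open Classical in
/-- The places that a robot visits after it has found the exit, until it is back there with the
treasure. -/
noncomputable def fetchStops (ε : ℤˣ) (ω : Placement α) : List ℂ :=
  if TreasureAhead ε ω ∧ IsFirst ε ω then [ω.exit * turn ε α, ω.exit]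
  else [ω.exit * turn ε α, ω.exit * turn ε (-α), ω.exit]

/-- The places that a robot visits after it has picked up the treasure in its search. In the second
case it learns where the exit is at the meeting point: if the other robot does not come, the exit is
ahead. In the last case the exit is known to be ahead, as otherwise the other robot would have
arrived before. -/
noncomputable def carryStops (ε : ℤˣ) (ω : Placement α) : List ℂ :=
  if hit ε ω.treasure ≤ soloTime α then [ω.treasure * turn ε (-α), ω.treasure * turn ε α]
  else if hit ε ω.treasure ≤ meetTime α then [meetPoint α ε ω.treasure, ω.exit]
  else [ω.treasure * turn ε α]

open Classical in
/-- The time at which a robot leaves the perimeter. -/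
noncomputable def searchEnd (ε : ℤˣ) (ω : Placement α) : ℝ :=
  if Grabs ε ω then hit ε ω.treasure else hit ε ω.exit

open Classical in
/-- The places that a robot visits after it has left the perimeter. -/
noncomputable def stops (ε : ℤˣ) (ω : Placement α) : List ℂ :=
  if Grabs ε ω then carryStops ε ω else fetchStops ε ω

/-- The motion of a robot that searches in the sense `ε`, from its arrival at the perimeter on. -/
noncomputable def tour (ε : ℤˣ) (ω : Placement α) : ℝ → ℂ :=
  concat (searchEnd ε ω) (turn ε) (walk (turn ε (searchEnd ε ω)) (stops ε ω))

lemma searchEnd_nonneg (ε : ℤˣ) (ω : Placement α) : 0 ≤ searchEnd ε ω := by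
  rw [searchEnd]
  split_ifs <;> exact hit_nonneg _ _

lemma searchEnd_of_grabs (hg : Grabs ε ω) : searchEnd ε ω = hit ε ω.treasure := if_pos hg

lemma searchEnd_of_not_grabs (hg : ¬ Grabs ε ω) : searchEnd ε ω = hit ε ω.exit := if_neg hg

lemma hit_treasure_le_searchEnd (h : hit ε ω.treasure < hit ε ω.exit) :
    hit ε ω.treasure ≤ searchEnd ε ω := by
  rw [searchEnd]
  split_ifs
  exacts [le_rfl, h.le]

lemma searchEnd_le_hit_exit (ε : ℤˣ) (ω : Placement α) : searchEnd ε ω ≤ hit ε ω.exit := by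
  rw [searchEnd]
  split_ifs with hg
  exacts [hg.1.le, le_rfl]

lemma tour_of_le (h : τ ≤ searchEnd ε ω) : tour ε ω τ = turn ε τ := concat_of_le h

lemma tour_zero (ε : ℤˣ) (ω : Placement α) : tour ε ω 0 = 1 := by
  rw [tour_of_le (searchEnd_nonneg ε ω), turn_zero]

lemma tour_searchEnd_add (ht : 0 ≤ t) :
    tour ε ω (searchEnd ε ω + t) = walk (turn ε (searchEnd ε ω)) (stops ε ω) t :=
  concat_add (walk_zero _ _).symm ht

lemma tour_of_grabs (hg : Grabs ε ω) (ht : 0 ≤ t) :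
    tour ε ω (hit ε ω.treasure + t) = walk ω.treasure (carryStops ε ω) t := by
  rw [← searchEnd_of_grabs hg, tour_searchEnd_add ht, searchEnd_of_grabs hg,
    turn_hit ε ω.norm_treasure, stops, if_pos hg]

lemma tour_of_not_grabs (hg : ¬ Grabs ε ω) (ht : 0 ≤ t) :
    tour ε ω (hit ε ω.exit + t) = walk ω.exit (fetchStops ε ω) t := by
  rw [← searchEnd_of_not_grabs hg, tour_searchEnd_add ht, searchEnd_of_not_grabs hg,
    turn_hit ε ω.norm_exit, stops, if_neg hg]

lemma lipschitzWith_tour (ε : ℤˣ) (ω : Placement α) : LipschitzWith 1 (tour ε ω) :=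
  lipschitzWith_concat (lipschitzWith_turn ε) (lipschitzWith_walk _ _) (walk_zero _ _).symm

lemma sub_hit_mem_Icc (ω : Placement α) (hz : ‖z‖ = 1)
    (h : hit ε z ∈ Set.Ioc (soloTime α) (meetTime α)) :
    meetTime α - hit ε z ∈ Set.Icc 0 (dist z (z * turn ε (-(2 * α)))) := by
  have h1 := h.1
  rw [dist_mul_turn_right hz, neg_div, Real.sin_neg, abs_neg, mul_div_cancel_left₀ _ two_ne_zero,
    abs_of_nonneg (sin_arc_nonneg ω)]
  refine ⟨sub_nonneg.2 h.2, ?_⟩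
  rw [soloTime, latestPickup] at h1
  rw [meetTime]
  linarith [sin_le_pi_sub (arc_mem_Icc ω).2]

lemma norm_meetPoint_le (ω : Placement α) (hz : ‖z‖ = 1)
    (h : hit ε z ∈ Set.Ioc (soloTime α) (meetTime α)) : ‖meetPoint α ε z‖ ≤ 1 := by
  have ⟨h0, h1⟩ := sub_hit_mem_Icc ω hz h
  have hmax := dist_leg_le_max h0 h1 0
  rwa [dist_zero_right, dist_zero_right, dist_zero_right, norm_mul, norm_turn, hz, mul_one,
    max_self] at hmax

lemma norm_le_one_of_mem_stops (hz : z ∈ stops ε ω) : ‖z‖ ≤ 1 := by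
  have hE (θ : ℝ) : ‖ω.exit * turn ε θ‖ ≤ 1 := by
    rw [norm_mul, norm_turn, ω.norm_exit, mul_one]
  have hT (θ : ℝ) : ‖ω.treasure * turn ε θ‖ ≤ 1 := by
    rw [norm_mul, norm_turn, ω.norm_treasure, mul_one]
  rw [stops, carryStops, fetchStops] at hz
  split_ifs at hz with _ hsolo hmeet <;>
    simp only [List.mem_cons, List.not_mem_nil, or_false] at hz
  · rcases hz with rfl | rfl <;> exact hT _
  · rcases hz with rfl | rfl
    exacts [norm_meetPoint_le ω ω.norm_treasure ⟨not_le.1 hsolo, hmeet⟩, ω.norm_exit.le]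
  · exact hz ▸ hT _
  · rcases hz with rfl | rfl
    exacts [hE _, ω.norm_exit.le]
  · rcases hz with rfl | rfl | rfl
    exacts [hE _, hE _, ω.norm_exit.le]

lemma norm_tour_le_one (hτ : 0 ≤ τ) : ‖tour ε ω τ‖ ≤ 1 := by
  have hturn (r : ℝ) : turn ε r ∈ Metric.closedBall (0 : ℂ) 1 :=
    mem_closedBall_zero_iff.2 (norm_turn ε r).le
  exact mem_closedBall_zero_iff.1 (concat_mem (fun r _ _ => hturn r) (fun r hr =>
    walk_mem (convex_closedBall _ _) (hturn _)
      (fun z hz => mem_closedBall_zero_iff.2 (norm_le_one_of_mem_stops hz)) hr) hτ)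

end Tour

/-! ### Pickup times -/

section Reach

variable {α : ℝ} {ε : ℤˣ} {ω : Placement α} {τ : ℝ}

lemma reach_of_lt (h : hit ε ω.treasure < hit ε ω.exit) : reach ε ω = hit ε ω.treasure := if_pos h

lemma reach_of_treasureAhead (h : hit ε ω.exit ≤ hit ε ω.treasure) (hA : TreasureAhead ε ω) :
    reach ε ω = hit ε ω.exit + 2 * Real.sin (α / 2) := by
  rw [reach, if_neg h.not_gt, if_pos hA]

lemma reach_of_not_treasureAhead (h : hit ε ω.exit ≤ hit ε ω.treasure)
    (hA : ¬ TreasureAhead ε ω) :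
    reach ε ω = hit ε ω.exit + 2 * Real.sin (α / 2) + 2 * Real.sin α := by
  rw [reach, if_neg h.not_gt, if_neg hA]

lemma reach_nonneg (ε : ℤˣ) (ω : Placement α) : 0 ≤ reach ε ω := by
  have := hit_nonneg ε ω.treasure
  have := hit_nonneg ε ω.exit
  have := sin_arc_nonneg ω
  have := sin_half_arc_nonneg ω
  rw [reach]
  split_ifs <;> linarith

lemma reach_le (ε : ℤˣ) (ω : Placement α) :
    reach ε ω ≤ hit ε ω.exit + 2 * Real.sin (α / 2) + 2 * Real.sin α := by
  have := sin_arc_nonneg ω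
  have := sin_half_arc_nonneg ω
  rw [reach]
  split_ifs <;> linarith

lemma tour_reach (ε : ℤˣ) (ω : Placement α) : tour ε ω (reach ε ω) = ω.treasure := by
  have hs := sin_half_arc_nonneg ω
  have hdist := dist_mul_turn_arc ω ω.norm_exit ε
  rcases lt_or_ge (hit ε ω.treasure) (hit ε ω.exit) with h | h
  · rw [reach_of_lt h, tour_of_le (hit_treasure_le_searchEnd h), turn_hit ε ω.norm_treasure]
  have hg : ¬ Grabs ε ω := fun hg => hg.1.not_ge h
  by_cases hA : TreasureAhead ε ω
  · rw [reach_of_treasureAhead h hA, tour_of_not_grabs hg (by linarith), ← hdist, fetchStops]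
    split_ifs <;> rw [walk_dist, hA]
  · rw [reach_of_not_treasureAhead h hA, add_assoc,
      tour_of_not_grabs hg (by linarith [sin_arc_nonneg ω]), fetchStops,
      if_neg fun hF => hA hF.1, ← hdist, ← dist_mul_turn_arc_mul_turn_neg_arc ω ω.norm_exit ε,
      walk_dist_add_dist, ← turn_neg]
    exact ((treasureAhead_or_neg ε ω).resolve_left hA).symm

lemma walk_fetchStops_ne_treasure {t : ℝ} (h0 : 0 < t) (hE : hit ε ω.exit ≤ hit ε ω.treasure)
    (h : hit ε ω.exit + t < reach ε ω) : walk ω.exit (fetchStops ε ω) t ≠ ω.treasure := by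
  have hnorm (θ : ℝ) : ‖ω.exit * turn ε θ‖ = 1 := by
    rw [norm_mul, norm_turn, ω.norm_exit, mul_one]
  have hdist := dist_mul_turn_arc ω ω.norm_exit ε
  have hQ {l : List ℂ} (ht : t < 2 * Real.sin (α / 2)) :
      walk ω.exit (ω.exit * turn ε α :: l) t ≠ ω.treasure := fun heq => by
    rw [← hdist] at ht
    rw [walk_of_le ht.le] at heq
    exact (norm_leg_lt ω.norm_exit.le (hnorm α).le h0 ht).ne (heq ▸ ω.norm_treasure)
  by_cases hA : TreasureAhead ε ω
  · rw [reach_of_treasureAhead hE hA] at h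
    rw [fetchStops]
    split_ifs <;> exact hQ (by linarith)
  rw [reach_of_not_treasureAhead hE hA] at h
  rw [fetchStops, if_neg fun hF => hA hF.1]
  rcases lt_or_ge t (2 * Real.sin (α / 2)) with ht | ht
  · exact hQ ht
  obtain ⟨u, rfl⟩ := exists_add_of_le ht
  have hu : 0 ≤ u := by linarith
  rw [← hdist, walk_dist_add hu]
  intro heq
  rcases hu.eq_or_lt with rfl | hu
  · exact hA (heq.symm.trans (walk_zero _ _))
  · have hu' : u < dist (ω.exit * turn ε α) (ω.exit * turn ε (-α)) := by
      rw [dist_mul_turn_arc_mul_turn_neg_arc ω ω.norm_exit]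
      linarith
    rw [walk_of_le hu'.le] at heq
    exact (norm_leg_lt (hnorm _).le (hnorm _).le hu hu').ne (heq ▸ ω.norm_treasure)

lemma tour_ne_treasure (h0 : 0 ≤ τ) (h : τ < reach ε ω) : tour ε ω τ ≠ ω.treasure := by
  rcases le_or_gt τ (searchEnd ε ω) with hτ | hτ
  · intro heq
    rw [tour_of_le hτ] at heq
    have hE := searchEnd_le_hit_exit ε ω
    have hT : hit ε ω.treasure = τ := hit_eq ⟨h0, by linarith [hit_lt ε ω.exit]⟩ heq
    rcases (hT.le.trans (hτ.trans hE)).lt_or_eq with hlt | heq'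
    · rw [reach_of_lt hlt] at h
      exact h.ne' hT
    · have hTE : ω.treasure = ω.exit := by
        rw [← turn_hit ε ω.norm_treasure, heq', turn_hit ε ω.norm_exit]
      have hα := arc_eq_zero_of_treasure_eq_exit hTE
      have := reach_le ε ω
      simp only [hα, zero_div, Real.sin_zero] at this
      linarith
  · by_cases hg : Grabs ε ω
    · rw [searchEnd_of_grabs hg] at hτ
      rw [reach_of_lt hg.1] at h
      exact absurd hτ h.not_gt
    rw [searchEnd_of_not_grabs hg] at hτ
    have hE : hit ε ω.exit ≤ hit ε ω.treasure := by
      by_contra! hlt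
      rw [reach_of_lt hlt] at h
      linarith
    rw [← add_sub_cancel (hit ε ω.exit) τ] at h ⊢
    rw [tour_of_not_grabs hg (by linarith)]
    exact walk_fetchStops_ne_treasure (by linarith) hE h

lemma hit_neg_exit (h : hit ε ω.treasure < hit ε ω.exit) (hA : TreasureAhead ε ω) :
    hit (-ε) ω.exit = α - hit ε ω.treasure := by
  have := hit_mul_turn_of_lt (ε := ε) ω.norm_exit (arc_mem_Ico ω) (hA ▸ h)
  rw [hit_neg_of_pos ω.norm_exit ((hit_nonneg _ _).trans_lt h), hA, this]
  ring

lemma reach_neg_le (h : hit ε ω.treasure < hit ε ω.exit) (hA : TreasureAhead ε ω) :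
    reach (-ε) ω ≤ 2 * meetTime α - hit ε ω.treasure := by
  have := reach_le (-ε) ω
  rw [hit_neg_exit h hA] at this
  rw [meetTime]
  linarith

/-- In the worst case the two robots together search the whole perimeter except for the arc between
the exit and the treasure, which one of them crosses along its chord. -/
lemma reach_add_reach_neg_le (ε : ℤˣ) (ω : Placement α) :
    reach ε ω + reach (-ε) ω ≤ 2 * latestPickup α := by
  wlog hA : TreasureAhead ε ω generalizing ε
  · have := this (-ε) ((treasureAhead_or_neg ε ω).resolve_left hA)
    rwa [neg_neg, add_comm] at this
  have hα := arc_mem_Icc ω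
  have hsin := sin_le_pi_sub hα.2
  have hhalf : Real.sin (α / 2) ≤ α / 2 := Real.sin_le (by linarith [hα.1])
  rw [latestPickup]
  rcases lt_or_ge (hit ε ω.treasure) (hit ε ω.exit) with h | h
  · have := reach_neg_le h hA
    rw [meetTime] at this
    linarith [reach_of_lt h]
  rw [reach_of_treasureAhead h hA]
  rcases (hit_nonneg ε ω.exit).eq_or_lt with hE | hE
  · have := reach_le (-ε) ω
    rw [hit_neg_of_eq_zero ω.norm_exit hE.symm] at this
    linarith
  rcases hα.1.eq_or_lt with h0 | h0
  · have := reach_le (-ε) ω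
    rw [hit_neg_of_pos ω.norm_exit hE] at this
    simp only [← h0, zero_div, Real.sin_zero] at this ⊢
    linarith
  · have hT : hit ε ω.treasure = hit ε ω.exit + α := by
      rw [hA]
      exact hit_mul_turn_of_le ω.norm_exit (arc_mem_Ico ω) (hA ▸ h)
    have hE' := hit_neg_of_pos ω.norm_exit hE
    have hT' := hit_neg_of_pos ω.norm_treasure (hE.trans_le h)
    rw [reach_of_lt (by linarith)]
    linarith

lemma IsFirst.reach_le_latestPickup (hF : IsFirst ε ω) : reach ε ω ≤ latestPickup α := by
  linarith [hF (-ε), reach_add_reach_neg_le ε ω]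

lemma Grabs.hit_treasure_le_latestPickup (hg : Grabs ε ω) :
    hit ε ω.treasure ≤ latestPickup α :=
  reach_of_lt hg.1 ▸ hg.2.reach_le_latestPickup

lemma Grabs.treasureAhead_neg (hg : Grabs ε ω) (h : meetTime α < hit ε ω.treasure) :
    TreasureAhead (-ε) ω :=
  (treasureAhead_or_neg ε ω).resolve_left fun hA => by
    have := hg.2 (-ε)
    rw [reach_of_lt hg.1] at this
    linarith [reach_neg_le hg.1 hA]

end Reach

/-! ### The time of the return to the exit -/

section Return

variable {α : ℝ} {ε : ℤˣ} {ω : Placement α}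

lemma exit_eq_mul_turn_or (ε : ℤˣ) (ω : Placement α) :
    ω.exit = ω.treasure * turn ε (-α) ∨ ω.exit = ω.treasure * turn ε α :=
  (treasureAhead_or_neg ε ω).imp treasureAhead_iff.1 treasureAhead_neg_iff.1

lemma dist_exit_treasure (ω : Placement α) :
    dist ω.exit ω.treasure = 2 * Real.sin (α / 2) := by
  rcases treasureAhead_or_neg 1 ω with h | h <;> rw [h, dist_mul_turn_arc ω ω.norm_exit]

lemma dist_meetPoint_exit_le (h : hit ε ω.treasure ∈ Set.Ioc (soloTime α) (meetTime α)) :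
    meetTime α + dist (meetPoint α ε ω.treasure) ω.exit
      ≤ latestPickup α + 2 * Real.sin (α / 2) := by
  have hα := arc_mem_Icc ω
  have ⟨h0, h1⟩ := sub_hit_mem_Icc ω ω.norm_treasure h
  have hfar : dist (ω.treasure * turn ε (-(2 * α))) ω.exit
      ≤ Real.pi + 2 * Real.sin (α / 2) - α - Real.sin α := by
    rcases exit_eq_mul_turn_or ε ω with hE | hE <;> rw [hE, dist_mul_turn ω.norm_treasure]
    · rw [show (-(2 * α) - -α) / 2 = -(α / 2) by ring, Real.sin_neg, abs_neg,
        abs_of_nonneg (sin_half_arc_nonneg ω)]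
      linarith [sin_le_pi_sub hα.2]
    · have := two_mul_add_sin_add_abs_sin_three_mul_le (x := α / 2) (by linarith [hα.1])
        (by linarith [hα.2])
      rw [mul_div_cancel₀ α two_ne_zero] at this
      rw [show (-(2 * α) - α) / 2 = -(3 * (α / 2)) by ring, Real.sin_neg, abs_neg]
      linarith
  have hnear : dist ω.treasure ω.exit ≤ Real.pi + 2 * Real.sin (α / 2) - α - Real.sin α := by
    rw [dist_comm, dist_exit_treasure]
    linarith [sin_le_pi_sub hα.2]
  have := (dist_leg_le_max h0 h1 ω.exit).trans (max_le hnear hfar)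
  rw [← meetPoint] at this
  rw [meetTime, latestPickup]
  linarith

lemma Grabs.exists_walk_eq_exit (hg : Grabs ε ω) :
    ∃ t ≥ 0, hit ε ω.treasure + t ≤ latestPickup α + 2 * Real.sin (α / 2) ∧
      walk ω.treasure (carryStops ε ω) t = ω.exit := by
  have hle := hg.hit_treasure_le_latestPickup
  have hdist := dist_exit_treasure ω
  rw [dist_comm] at hdist
  rw [carryStops]
  split_ifs with hsolo hmeet
  · rw [soloTime] at hsolo
    rcases exit_eq_mul_turn_or ε ω with hE | hE
    · exact ⟨dist ω.treasure ω.exit, dist_nonneg, by linarith, by rw [← hE, walk_dist]⟩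
    · refine ⟨dist ω.treasure (ω.treasure * turn ε (-α)) +
        dist (ω.treasure * turn ε (-α)) (ω.treasure * turn ε α), by positivity, ?_, ?_⟩
      · rw [dist_mul_turn_neg_arc ω ω.norm_treasure, dist_comm,
          dist_mul_turn_arc_mul_turn_neg_arc ω ω.norm_treasure]
        linarith
      · rw [walk_dist_add_dist, hE]
  · have hy : hit ε ω.treasure ∈ Set.Ioc (soloTime α) (meetTime α) := ⟨not_le.1 hsolo, hmeet⟩
    have ⟨h0, h1⟩ := sub_hit_mem_Icc ω ω.norm_treasure hy
    have hM : dist ω.treasure (meetPoint α ε ω.treasure) = meetTime α - hit ε ω.treasure :=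
      dist_left_leg h0 h1
    exact ⟨_, add_nonneg dist_nonneg dist_nonneg, by linarith [dist_meetPoint_exit_le hy],
      walk_dist_add_dist _ _ _ _⟩
  · have hE := treasureAhead_neg_iff.1 (hg.treasureAhead_neg (not_le.1 hmeet))
    exact ⟨dist ω.treasure ω.exit, dist_nonneg, by linarith, by rw [← hE, walk_dist]⟩

lemma IsFirst.exists_walk_eq_exit (hF : IsFirst ε ω) (h : hit ε ω.exit ≤ hit ε ω.treasure) :
    ∃ t ≥ 0, hit ε ω.exit + t = reach ε ω + 2 * Real.sin (α / 2) ∧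
      walk ω.exit (fetchStops ε ω) t = ω.exit := by
  have hQ := dist_mul_turn_arc ω ω.norm_exit ε
  have hP := dist_mul_turn_neg_arc ω ω.norm_exit ε
  have hQP := dist_mul_turn_arc_mul_turn_neg_arc ω ω.norm_exit ε
  rw [fetchStops]
  by_cases hA : TreasureAhead ε ω
  · rw [if_pos ⟨hA, hF⟩, reach_of_treasureAhead h hA]
    refine ⟨_, add_nonneg dist_nonneg dist_nonneg, ?_, walk_dist_add_dist _ _ _ _⟩
    rw [dist_comm _ ω.exit, hQ]
    ring
  · rw [if_neg fun hF => hA hF.1, reach_of_not_treasureAhead h hA]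
    refine ⟨dist ω.exit (ω.exit * turn ε α) + (dist (ω.exit * turn ε α) (ω.exit * turn ε (-α)) +
      dist (ω.exit * turn ε (-α)) ω.exit), by positivity, ?_, ?_⟩
    · rw [dist_comm _ ω.exit, hQ, hQP, hP]
      ring
    · rw [walk_dist_add (by positivity), walk_dist_add_dist]

lemma IsFirst.exists_tour_eq_exit (hF : IsFirst ε ω) :
    ∃ τ ≥ reach ε ω, τ ≤ latestPickup α + 2 * Real.sin (α / 2) ∧ tour ε ω τ = ω.exit := by
  rcases lt_or_ge (hit ε ω.treasure) (hit ε ω.exit) with h | h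
  · obtain ⟨t, ht, hle, hwalk⟩ := Grabs.exists_walk_eq_exit ⟨h, hF⟩
    refine ⟨hit ε ω.treasure + t, ?_, hle, ?_⟩
    · rw [reach_of_lt h]
      linarith
    · rw [tour_of_grabs ⟨h, hF⟩ ht, hwalk]
  · obtain ⟨t, ht, heq, hwalk⟩ := hF.exists_walk_eq_exit h
    refine ⟨hit ε ω.exit + t, ?_, ?_, ?_⟩
    · linarith [sin_half_arc_nonneg ω]
    · linarith [hF.reach_le_latestPickup]
    · rw [tour_of_not_grabs (fun hg => hg.1.not_ge h) ht, hwalk]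

end Return

/-! ### Decisions based on observations -/

section Online

variable {α : ℝ} {ε : ℤˣ} {ω ω' : Placement α} {b : ℂ} {c τ : ℝ}

/-- The robot that searches in the sense `ε` is at the hiding place of the treasure at time `τ`, and
the treasure has not been taken away. -/
def Finds (ε : ℤˣ) (ω : Placement α) (τ : ℝ) : Prop :=
  tour ε ω τ = ω.treasure ∧ ∀ δ, τ ≤ reach δ ω

/-- What the robot that searches in the sense `ε` learns at time `τ` under `ω` also holds under
`ω'`. This is only the part of the observation that the algorithm makes use of; in particular, all
that the robot is interested to hear from the other one is where the exit is. -/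
structure Conveys (ε : ℤˣ) (ω ω' : Placement α) (τ : ℝ) : Prop where
  exit : tour ε ω τ = ω.exit → tour ε ω' τ = ω'.exit
  finds : Finds ε ω τ → Finds ε ω' τ
  told : tour (-ε) ω τ = tour ε ω τ → ∀ r ∈ Set.Icc 0 τ, tour (-ε) ω r = ω.exit →
    ω.exit = ω'.exit

/-- As long as the robot that searches in the sense `ε` moves in the same way under `ω` and `ω'`
before time `τ`, it learns the same under both placements. -/
def Indistinguishable (ε : ℤˣ) (ω ω' : Placement α) (τ : ℝ) : Prop :=
  ∀ s ∈ Set.Ico 0 τ, (∀ r ∈ Set.Icc 0 s, tour ε ω r = tour ε ω' r) →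
    Conveys ε ω ω' s ∧ Conveys ε ω' ω s

lemma Indistinguishable.symm (H : Indistinguishable ε ω ω' τ) : Indistinguishable ε ω' ω τ :=
  fun s hs h => (H s hs fun r hr => (h r hr).symm).symm

lemma Indistinguishable.tour_eq (H : Indistinguishable ε ω ω' τ) (hc : 0 ≤ c)
    (agree : ∀ r ≤ c, tour ε ω r = tour ε ω' r)
    (decide : Conveys ε ω ω' c → Conveys ε ω' ω c → tour ε ω τ = tour ε ω' τ) :
    tour ε ω τ = tour ε ω' τ := by
  rcases le_or_gt τ c with hτ | hτ
  · exact agree τ hτ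
  · exact (H c ⟨hc, hτ⟩ fun r hr => agree r hr.2).elim decide

lemma tour_congr (hs : searchEnd ε ω = searchEnd ε ω') (h : stops ε ω = stops ε ω') :
    tour ε ω = tour ε ω' := by
  rw [tour, tour, hs, h]

lemma tour_eq_of_head?_eq (hs : searchEnd ε ω = searchEnd ε ω') (hb : (stops ε ω).head? = some b)
    (hb' : (stops ε ω').head? = some b)
    (hτ : τ ≤ searchEnd ε ω + dist (turn ε (searchEnd ε ω)) b) :
    tour ε ω τ = tour ε ω' τ := by
  obtain ⟨l, hl⟩ := List.head?_eq_some_iff.1 hb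
  obtain ⟨l', hl'⟩ := List.head?_eq_some_iff.1 hb'
  rw [tour, tour, concat, concat, ← hs, hl, hl', walk_of_le (by linarith), walk_of_le (by linarith)]

lemma finds_iff (hg : ¬ Grabs ε ω) :
    Finds ε ω (hit ε ω.exit + 2 * Real.sin (α / 2)) ↔ TreasureAhead ε ω ∧ IsFirst ε ω := by
  have hs := sin_half_arc_nonneg ω
  have hpos : tour ε ω (hit ε ω.exit + 2 * Real.sin (α / 2)) = ω.exit * turn ε α := by
    rw [tour_of_not_grabs hg (by linarith), ← dist_mul_turn_arc ω ω.norm_exit ε, fetchStops]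
    split_ifs <;> exact walk_dist _ _ _
  rw [Finds, hpos, eq_comm, ← TreasureAhead]
  refine and_congr_right fun hA => ?_
  rcases lt_or_ge (hit ε ω.treasure) (hit ε ω.exit) with h | h
  · refine iff_of_false (fun hle => ?_) fun hF => hg ⟨h, hF⟩
    have := hle ε
    rw [reach_of_lt h] at this
    linarith
  · rw [IsFirst, reach_of_treasureAhead h hA]

lemma tour_hit_exit (hg : ¬ Grabs ε ω) : tour ε ω (hit ε ω.exit) = ω.exit := by
  rw [← add_zero (hit _ _), tour_of_not_grabs hg le_rfl, walk_zero]

lemma tour_meetTime (hg : Grabs ε ω)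
    (hy : hit ε ω.treasure ∈ Set.Ioc (soloTime α) (meetTime α)) :
    tour ε ω (meetTime α) = meetPoint α ε ω.treasure := by
  have ⟨h0, h1⟩ := sub_hit_mem_Icc ω ω.norm_treasure hy
  rw [← add_sub_cancel (hit ε ω.treasure) (meetTime α), tour_of_grabs hg h0, carryStops,
    if_neg hy.1.not_ge, if_pos hy.2, ← dist_left_leg h0 h1, ← meetPoint, walk_dist]

lemma soloTime_nonneg (ω : Placement α) : 0 ≤ soloTime α := by
  rw [soloTime, latestPickup]
  linarith [two_mul_sin_le_pi_sub_half (arc_mem_Icc ω).2, sin_half_arc_nonneg ω]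

lemma sin_arc_pos (ω : Placement α) (h : soloTime α < meetTime α) : 0 < Real.sin α := by
  rw [soloTime, latestPickup, meetTime] at h
  linarith [(arc_mem_Icc ω).2]

lemma fetchStops_of_treasureAhead_neg (hsin : 0 < Real.sin α) (hA : TreasureAhead (-ε) ω) :
    fetchStops ε ω = [ω.exit * turn ε α, ω.exit * turn ε (-α), ω.exit] := by
  rw [fetchStops, if_neg fun h => ?_]
  have := dist_mul_turn_arc_mul_turn_neg_arc ω ω.norm_exit ε
  rw [← turn_neg, ← h.1, ← hA, dist_self] at this
  linarith

lemma not_grabs_neg (h : hit ε ω.treasure < hit ε ω.exit) (hA : TreasureAhead ε ω)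
    (hT : 0 < hit ε ω.treasure) : ¬ Grabs (-ε) ω := fun hg => by
  have := hg.1
  rw [hit_neg_exit h hA, hit_neg_of_pos ω.norm_treasure hT] at this
  linarith [(arc_mem_Ico ω).2]

/-- The other robot has left the exit for the point at distance `2 * α` behind the treasure and is
now on the way from there to the treasure, so that the two robots meet on the chord. -/
lemma tour_neg_meetTime (h : hit ε ω.treasure < hit ε ω.exit) (hA : TreasureAhead ε ω)
    (hy : hit ε ω.treasure ∈ Set.Ioc (soloTime α) (meetTime α)) :
    tour (-ε) ω (meetTime α) = meetPoint α ε ω.treasure := by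
  have ⟨h0, h1⟩ := sub_hit_mem_Icc ω ω.norm_treasure hy
  have hg := not_grabs_neg h hA ((soloTime_nonneg ω).trans_lt hy.1)
  have hP : ω.exit * turn (-ε) (-α) = ω.treasure := by rw [turn_neg, neg_neg, hA]
  have hQ : ω.exit * turn (-ε) α = ω.treasure * turn ε (-(2 * α)) := by
    rw [hA, mul_assoc, ← turn_add, turn_neg]
    congr 2
    ring
  have hPQ := dist_mul_turn_arc_mul_turn_neg_arc ω ω.norm_exit (-ε)
  rw [hP, hQ, dist_comm] at hPQ
  have htime : meetTime α = hit (-ε) ω.exit + (dist ω.exit (ω.exit * turn (-ε) α) +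
      (2 * Real.sin α - (meetTime α - hit ε ω.treasure))) := by
    rw [hit_neg_exit h hA, dist_mul_turn_arc ω ω.norm_exit, meetTime]
    ring
  have hA' : TreasureAhead (- -ε) ω := by rwa [neg_neg]
  have hsin := sin_arc_pos ω (hy.1.trans_le hy.2)
  rw [htime, tour_of_not_grabs hg (add_nonneg dist_nonneg (by linarith)),
    fetchStops_of_treasureAhead_neg hsin hA', walk_dist_add (by linarith), hQ, hP,
    walk_of_le (by rw [dist_comm]; linarith), leg_symm, hPQ, sub_sub_cancel, meetPoint]

lemma Conveys.exit_eq (hc : Conveys ε ω ω' (meetTime α)) (hg : Grabs ε ω)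
    (hA : TreasureAhead ε ω) (hy : hit ε ω.treasure ∈ Set.Ioc (soloTime α) (meetTime α)) :
    ω.exit = ω'.exit := by
  have hpos := (soloTime_nonneg ω).trans_lt hy.1
  refine hc.told ?_ (hit (-ε) ω.exit) ⟨hit_nonneg _ _, ?_⟩
    (tour_hit_exit (not_grabs_neg hg.1 hA hpos))
  · rw [tour_neg_meetTime hg.1 hA hy, tour_meetTime hg hy]
  · have hlt := hy.1
    rw [soloTime, latestPickup] at hlt
    rw [hit_neg_exit hg.1 hA, meetTime]
    linarith [(arc_mem_Icc ω).2, sin_le_pi_sub (arc_mem_Icc ω).2, sin_half_arc_nonneg ω]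

lemma tour_eq_of_carry (hg : Grabs ε ω) (hg' : Grabs ε ω') (hT : ω.treasure = ω'.treasure)
    (H : Indistinguishable ε ω ω' τ) : tour ε ω τ = tour ε ω' τ := by
  have hs : searchEnd ε ω = searchEnd ε ω' := by
    rw [searchEnd_of_grabs hg, searchEnd_of_grabs hg', hT]
  by_cases hy : hit ε ω.treasure ∈ Set.Ioc (soloTime α) (meetTime α)
  · have hy' := hT ▸ hy
    have ⟨h0, h1⟩ := sub_hit_mem_Icc ω ω.norm_treasure hy
    have hstops {ω : Placement α} (hg : Grabs ε ω)
        (hy : hit ε ω.treasure ∈ Set.Ioc (soloTime α) (meetTime α)) :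
        stops ε ω = [meetPoint α ε ω.treasure, ω.exit] := by
      rw [stops, if_pos hg, carryStops, if_neg hy.1.not_ge, if_pos hy.2]
    refine H.tour_eq (c := meetTime α) (by linarith [hit_nonneg ε ω.treasure])
      (fun r hr => tour_eq_of_head?_eq hs (by rw [hstops hg hy]; rfl)
        (by rw [hstops hg' hy', ← hT]; rfl) ?_)
      fun hc hc' => ?_
    · rw [searchEnd_of_grabs hg, turn_hit ε ω.norm_treasure, meetPoint, dist_left_leg h0 h1]
      linarith
    · have hE : ω.exit = ω'.exit := by
        by_cases hA : TreasureAhead ε ω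
        · exact hc.exit_eq hg hA hy
        by_cases hA' : TreasureAhead ε ω'
        · exact (hc'.exit_eq hg' hA' hy').symm
        rw [(exit_eq_mul_turn_or ε ω).resolve_left (hA ∘ treasureAhead_iff.2), hT,
          (exit_eq_mul_turn_or ε ω').resolve_left (hA' ∘ treasureAhead_iff.2)]
      rw [tour_congr hs (by rw [hstops hg hy, hstops hg' hy', hT, hE])]
  · refine congrFun (tour_congr hs ?_) τ
    rw [stops, stops, if_pos hg, if_pos hg', carryStops, carryStops, ← hT]
    split_ifs with hsolo hmeet
    exacts [rfl, absurd ⟨not_le.1 hsolo, hmeet⟩ hy, rfl]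

lemma tour_eq_of_fetch (hg : ¬ Grabs ε ω) (hg' : ¬ Grabs ε ω') (hE : ω.exit = ω'.exit)
    (H : Indistinguishable ε ω ω' τ) : tour ε ω τ = tour ε ω' τ := by
  have hs : searchEnd ε ω = searchEnd ε ω' := by
    rw [searchEnd_of_not_grabs hg, searchEnd_of_not_grabs hg', hE]
  have hhead {ω : Placement α} (hg : ¬ Grabs ε ω) :
      (stops ε ω).head? = some (ω.exit * turn ε α) := by
    rw [stops, if_neg hg, fetchStops]
    split_ifs <;> rfl
  refine H.tour_eq (c := hit ε ω.exit + 2 * Real.sin (α / 2))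
    (by linarith [hit_nonneg ε ω.exit, sin_half_arc_nonneg ω])
    (fun r hr => tour_eq_of_head?_eq hs (hhead hg) (hE ▸ hhead hg') ?_) fun hc hc' => ?_
  · rwa [searchEnd_of_not_grabs hg, turn_hit ε ω.norm_exit, dist_mul_turn_arc ω ω.norm_exit]
  · have hiff : TreasureAhead ε ω ∧ IsFirst ε ω ↔ TreasureAhead ε ω' ∧ IsFirst ε ω' := by
      rw [← finds_iff hg, ← finds_iff hg', ← hE]
      exact ⟨hc.finds, hc'.finds⟩
    refine congrFun (tour_congr hs ?_) τ
    rw [stops, stops, if_neg hg, if_neg hg', fetchStops, fetchStops, hE]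
    split_ifs <;> tauto

lemma Indistinguishable.tour_eq_tour (H : Indistinguishable ε ω ω' τ) :
    tour ε ω τ = tour ε ω' τ := by
  wlog hle : searchEnd ε ω ≤ searchEnd ε ω' generalizing ω ω'
  · exact (this H.symm (le_of_not_ge hle)).symm
  have agree (r : ℝ) (hr : r ≤ searchEnd ε ω) : tour ε ω r = tour ε ω' r := by
    rw [tour_of_le hr, tour_of_le (hr.trans hle)]
  refine H.tour_eq (searchEnd_nonneg ε ω) agree fun hc hc' => ?_
  have hsame := agree _ le_rfl
  by_cases hg : Grabs ε ω
  · rw [searchEnd_of_grabs hg] at *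
    have hpos : tour ε ω (hit ε ω.treasure) = ω.treasure := reach_of_lt hg.1 ▸ tour_reach ε ω
    have hfinds := hc.finds ⟨hpos, fun δ => reach_of_lt hg.1 ▸ hg.2 δ⟩
    have hT : ω.treasure = ω'.treasure := by rw [← hfinds.1, ← hsame, hpos]
    have hlt : hit ε ω'.treasure < hit ε ω'.exit := by
      rw [← hT]
      refine lt_of_le_of_ne (hle.trans (searchEnd_le_hit_exit ε ω')) fun heq => ?_
      have hE : ω'.exit = ω.treasure := by
        rw [← turn_hit ε ω'.norm_exit, ← heq, turn_hit ε ω.norm_treasure]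
      have := hc'.exit (by rw [← hsame, hpos, hE])
      exact hg.1.ne (congrArg _ (hpos.symm.trans this))
    refine tour_eq_of_carry hg ⟨hlt, fun δ => ?_⟩ hT H
    rw [reach_of_lt hlt, ← hT]
    exact hfinds.2 δ
  · rw [searchEnd_of_not_grabs hg] at *
    have hexit := tour_hit_exit hg
    have hE : ω.exit = ω'.exit := by rw [← hc.exit hexit, ← hsame, hexit]
    refine tour_eq_of_fetch hg (fun hg' => ?_) hE H
    rw [searchEnd_of_grabs hg', hE] at hle
    exact hg'.1.not_ge hle

end Online

/-! ### The algorithm -/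

section Execution

variable {T : ℂ} {p : Fin 2 → ℝ≥0 → ℂ} {i : Fin 2} {s t : ℝ≥0}

/-- At time `t` robot `i` is at `T`, which no robot has visited before. It is not excluded that the
other robot arrives at the same time. -/
def IsFirstVisit (T : ℂ) (p : Fin 2 → ℝ≥0 → ℂ) (i : Fin 2) (t : ℝ≥0) : Prop :=
  p i t = T ∧ ∀ r < t, ∀ j, p j r ≠ T

lemma IsFirstVisit.exists_holds (h : IsFirstVisit T p i t) : ∃ j, Holds T p j t ∧ p j t = T := by
  by_cases h0 : p 0 t = T
  · exact ⟨0, ⟨t, le_rfl, h0, h.2, fun j hj => absurd hj (Fin.not_lt_zero j)⟩, h0⟩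
  · have hi : i = 1 := Fin.eq_one_of_ne_zero i fun hi => h0 (hi ▸ h.1)
    refine ⟨i, ⟨t, le_rfl, h.1, h.2, fun j hj => ?_⟩, h.1⟩
    rwa [(Fin.lt_one_iff j).1 (hi ▸ hj)]

lemma holds_mono (h : Holds T p i s) (hst : s ≤ t) : Holds T p i t :=
  let ⟨r, hr, hT⟩ := h
  ⟨r, hr.trans hst, hT⟩

variable {α : ℝ} {ω ω' : Placement α} {p' : Fin 2 → ℝ≥0 → ℂ}

lemma sameObservation_symm (h : SameObservation ω ω' p p' i t) :
    SameObservation ω' ω p' p i t :=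
  ⟨⟨h.1.1.symm, h.1.2.symm⟩, fun j => ⟨(h.2 j).1.symm, fun hj r hr =>
    have ⟨hpos, hdet⟩ := (h.2 j).2 ((h.2 j).1.2 hj) r hr
    ⟨hpos.symm, hdet.1.symm, hdet.2.symm⟩⟩⟩

/-- If the treasure was detected at time `t` because a robot has brought it there, this robot would
report an earlier detection. -/
lemma IsFirstVisit.of_sameObservation (h : IsFirstVisit ω.treasure p i t)
    (hobs : SameObservation ω ω' p p' i t) : IsFirstVisit ω'.treasure p' i t := by
  obtain ⟨k, hk, hkT⟩ := h.exists_holds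
  rcases hobs.1.2.1 (.inl ⟨k, hk, hkT.trans h.1.symm⟩) with
    ⟨j, ⟨s, hst, hjs, hfirst, hmin⟩, hj⟩ | ⟨hT, hnever⟩
  · rcases hst.eq_or_lt with rfl | hlt
    · exact ⟨hj.symm.trans hjs, hfirst⟩
    · have hpast := ((hobs.2 j).2 ((hobs.2 j).1.2 hj) s hst).2.2.2
      rcases hpast (.inl ⟨j, ⟨s, le_rfl, hjs, hfirst, hmin⟩, rfl⟩) with
        ⟨l, ⟨r, hr, hlr, -⟩, -⟩ | ⟨hT, -⟩
      · exact absurd hlr (h.2 r (hr.trans_lt hlt) l)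
      · exact absurd hT (h.2 s hlt j)
  · exact absurd hT (hnever t le_rfl i)

end Execution

section Algorithm

variable {α : ℝ} {ω ω' : Placement α} {i : Fin 2} {t τ : ℝ≥0}

/-- The sense in which robot `i` searches the perimeter. -/
def sense (i : Fin 2) : ℤˣ := (-1) ^ (i : ℕ)

lemma sense_surjective : Function.Surjective sense := fun ε => by
  rcases Int.units_eq_one_or ε with rfl | rfl
  exacts [⟨0, rfl⟩, ⟨1, rfl⟩]

/-- The motion of robot `i`: straight to the perimeter, and then along its tour. -/
noncomputable def motion (ω : Placement α) (i : Fin 2) (t : ℝ≥0) : ℂ :=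
  concat 1 ((↑) : ℝ → ℂ) (tour (sense i) ω) t

lemma motion_of_le (h : t ≤ 1) : motion ω i t = (t : ℝ) := concat_of_le h

lemma motion_one_add (ω : Placement α) (i : Fin 2) (τ : ℝ≥0) :
    motion ω i (1 + τ) = tour (sense i) ω τ := by
  rw [motion, NNReal.coe_add, NNReal.coe_one]
  exact concat_add (by rw [tour_zero, Complex.ofReal_one]) τ.2

lemma isTrajectory_motion (ω : Placement α) (i : Fin 2) : IsTrajectory (motion ω i) where
  start := by rw [motion_of_le zero_le_one, NNReal.coe_zero, Complex.ofReal_zero]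
  mem_disk t := by
    rcases le_total t 1 with ht | ht
    · rw [motion_of_le ht, Complex.norm_real, NNReal.norm_eq]
      exact ht
    · obtain ⟨τ, rfl⟩ := exists_add_of_le ht
      rw [motion_one_add]
      exact norm_tour_le_one τ.2
  speed := by
    have h := lipschitzWith_concat (c := 1) Complex.isometry_ofReal.lipschitz
      (lipschitzWith_tour (sense i) ω) (by rw [tour_zero, Complex.ofReal_one])
    exact LipschitzWith.of_dist_le_mul fun s t => h.dist_le_mul s t

lemma motion_ne_treasure (h : (t : ℝ) < 1 + reach (sense i) ω) : motion ω i t ≠ ω.treasure := by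
  rcases lt_or_ge t 1 with ht | ht
  · refine ne_of_apply_ne norm ?_
    rw [motion_of_le ht.le, Complex.norm_real, NNReal.norm_eq, ω.norm_treasure]
    exact_mod_cast ht.ne
  · obtain ⟨τ, rfl⟩ := exists_add_of_le ht
    rw [NNReal.coe_add, NNReal.coe_one] at h
    rw [motion_one_add]
    exact tour_ne_treasure τ.2 (lt_of_add_lt_add_left h)

lemma isFirstVisit_motion_iff :
    IsFirstVisit ω.treasure (motion ω) i (1 + τ) ↔ Finds (sense i) ω τ := by
  rw [IsFirstVisit, Finds, motion_one_add]
  refine and_congr_right fun _ => ⟨fun h ε => ?_, fun h r hr j => motion_ne_treasure ?_⟩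
  · obtain ⟨j, rfl⟩ := sense_surjective ε
    by_contra! hlt
    lift reach (sense j) ω to ℝ≥0 using reach_nonneg _ _ with u hu
    refine h (1 + u) (by gcongr; exact_mod_cast hlt) j ?_
    rw [motion_one_add, hu, tour_reach]
  · calc (r : ℝ) < 1 + τ := by exact_mod_cast hr
      _ ≤ 1 + reach (sense j) ω := by gcongr; exact h (sense j)

lemma conveys_of_sameObservation
    (h : SameObservation ω ω' (motion ω) (motion ω') i (1 + τ)) : Conveys (sense i) ω ω' τ where
  exit := by
    have := h.1.1.1
    rwa [motion_one_add, motion_one_add] at this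
  finds hF := isFirstVisit_motion_iff.1 ((isFirstVisit_motion_iff.2 hF).of_sameObservation h)
  told hmeet r hr hE := by
    obtain ⟨j, hj⟩ := sense_surjective (-sense i)
    lift r to ℝ≥0 using hr.1
    rw [← hj, ← motion_one_add] at hmeet hE
    rw [← motion_one_add] at hmeet
    obtain ⟨heq, hdet, -⟩ := (h.2 j).2 hmeet (1 + r) (by gcongr; exact hr.2)
    rw [← hE, heq, hdet.1 hE]

/-- The algorithm that lets both robots move straight to the same point of the perimeter and search
the perimeter in opposite senses. Once a robot has left the perimeter, it visits `stops`. -/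
noncomputable def algorithm (α : ℝ) : F2FAlgorithm α where
  pos := motion
  isTrajectory := isTrajectory_motion
  online ω ω' i t hne := by
    by_contra! H
    rcases le_total t 1 with ht | ht
    · exact hne (by rw [motion_of_le ht, motion_of_le ht])
    obtain ⟨τ, rfl⟩ := exists_add_of_le ht
    rw [motion_one_add, motion_one_add] at hne
    refine hne (Indistinguishable.tour_eq_tour fun s hs hag => ?_)
    lift s to ℝ≥0 using hs.1
    have hobs := H (1 + s) (by gcongr; exact hs.2) fun r hr => by
      rcases le_total r 1 with hr1 | hr1
      · rw [motion_of_le hr1, motion_of_le hr1]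
      · obtain ⟨u, rfl⟩ := exists_add_of_le hr1
        rw [motion_one_add, motion_one_add]
        exact hag u ⟨u.2, le_of_add_le_add_left hr⟩
    exact ⟨conveys_of_sameObservation hobs,
      conveys_of_sameObservation (sameObservation_symm hobs)⟩

lemma algorithm_evacuatesBy (ω : Placement α) :
    (algorithm α).EvacuatesBy ω (1 + Real.pi - α / 2 + 3 * Real.sin (α / 2)) := by
  obtain ⟨ε, hε⟩ := Finite.exists_min fun ε => reach ε ω
  obtain ⟨i, rfl⟩ := sense_surjective ε
  obtain ⟨u, hu⟩ : ∃ u : ℝ≥0, (u : ℝ) = reach (sense i) ω := ⟨⟨_, reach_nonneg _ _⟩, rfl⟩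
  have hvisit : IsFirstVisit ω.treasure (motion ω) i (1 + u) := by
    rw [isFirstVisit_motion_iff, hu]
    exact ⟨tour_reach _ _, hε⟩
  obtain ⟨j, hj, hjT⟩ := hvisit.exists_holds
  have hjF : reach (sense j) ω ≤ u := by
    by_contra! hlt
    exact motion_ne_treasure (by rw [NNReal.coe_add, NNReal.coe_one]; gcongr) hjT
  obtain ⟨τ, hτ, hle, hE⟩ := IsFirst.exists_tour_eq_exit fun δ => (hjF.trans hu.le).trans (hε δ)
  lift τ to ℝ≥0 using (reach_nonneg _ _).trans hτ
  refine ⟨1 + τ, ?_, j, holds_mono hj ?_, (motion_one_add ω j τ).trans hE⟩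
  · rw [latestPickup] at hle
    rw [NNReal.coe_add, NNReal.coe_one]
    linarith
  · gcongr
    exact_mod_cast hu.le.trans ((hε _).trans hτ)

end Algorithm

end TreasureHunt

theorem mainTheorem1 (α : ℝ) (hα : α ∈ Set.Icc 0 Real.pi) :
    SolvableF2F α (1 + Real.pi - α / 2 + 3 * Real.sin (α / 2)) :=
  ⟨TreasureHunt.algorithm α, TreasureHunt.algorithm_evacuatesBy⟩
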